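/- Let $k$ be a field and let $H$ be a finite-dimensional Hopf algebra over $k$ with comultiplication $\Delta(a)=a_{(1)}\otimes a_{(2)}$, counit $\varepsilon$ and antipode $S$. Let $K\subseteq H$ be a normal Hopf subalgebra, that is, a subalgebra with $\Delta(K)\subseteq K\otimes K$ and $S(K)\subseteq K$ such that $S(a_{(1)})\,x\,a_{(2)}\in K$ and $a_{(1)}\,x\,S(a_{(2)})\in K$ for all $a\in H$, $x\in K$. Put $K^+=K\cap\ker\varepsilon$ and let $HK^+$ be the left ideal of $H$ generated by $K^+$. Then $HK^+$ is a (two-sided) Hopf ideal of $H$, so that $\overline H=H/HK^+$ is a Hopf algebra, with quotient map $a\mapsto\overline a$, and: 1. The extension $H\,|\,K$ is $\overline H$-Galois with respect to the natural coaction $\rho\colon H\to H\otimes_k\overline H$, $\rho(a)=a_{(1)}\otimes\overline{a_{(2)}}$. That is, $\rho$ makes $H$ a right $\overline H$-comodule algebra, its subalgebra of coinvariants $\{a\in H : \rho(a)=a\otimes\overline 1\}$ equals $K$, and the Galois map $\beta\colon H\otimes_K H\to H\otimes_k\overline H$, $\beta(x\otimes y)=x\,y_{(1)}\otimes\overline{y_{(2)}}$,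 is bijective. 2. The extension $H\,|\,K$ is of depth two: for some $n$, the bimodule $H\otimes_K H$ is isomorphic to a direct summand of $H^n$ as a $K$-$H$-bimodule (left depth two), and for some $n$ it is isomorphic to a direct summand of $H^n$ as an $H$-$K$-bimodule (right depth two). -/

import Mathlib

open scoped TensorProduct

noncomputable section

namespace HopfDepthTwo

/-! ### The tensor square `A ⊗_B A` of an algebra over a (noncommutative) subalgebra -/

section TensorSquare

variable {k A : Type*} [CommRing k] [Ring A] [Algebra k A]

/-- The span of the relations `x b ⊗ y = x ⊗ b y` with `b ∈ B` in `A ⊗_k A`. -/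
def balancing (B : Subalgebra k A) : Submodule k (A ⊗[k] A) :=
  Submodule.span k {t | ∃ x y : A, ∃ b ∈ B, t = (x * b) ⊗ₜ[k] y - x ⊗ₜ[k] (b * y)}

/-- The tensor product `A ⊗_B A`, where `A` is a right and a left `B`-module by multiplication.
Since `k` acts through `B`, it is the quotient of `A ⊗_k A` by the `B`-balancing relations. -/
def TensorSquare (B : Subalgebra k A) : Type _ := (A ⊗[k] A) ⧸ balancing B

namespace TensorSquare

variable (B : Subalgebra k A)

instance : AddCommGroup (TensorSquare B) :=
  inferInstanceAs (AddCommGroup ((A ⊗[k] A) ⧸ balancing B))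

instance : Module k (TensorSquare B) :=
  inferInstanceAs (Module k ((A ⊗[k] A) ⧸ balancing B))

/-- The projection `A ⊗_k A → A ⊗_B A`. -/
def proj : A ⊗[k] A →ₗ[k] TensorSquare B := (balancing B).mkQ

/-- The element `x ⊗_B y`. -/
def tmul (x y : A) : TensorSquare B := proj B (x ⊗ₜ[k] y)

lemma proj_surjective : Function.Surjective (proj B) := (balancing B).mkQ_surjective

variable {B} in
lemma hom_ext {M : Type*} [AddCommGroup M] [Module k M] {f g : TensorSquare B →ₗ[k] M}
    (h : ∀ x y, f (tmul B x y) = g (tmul B x y)) : f = g := by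
  have : f ∘ₗ proj B = g ∘ₗ proj B := TensorProduct.ext' h
  exact (LinearMap.cancel_right (proj_surjective B)).mp this

variable {B} in
lemma mul_tmul (x y : A) {b : A} (hb : b ∈ B) : tmul B (x * b) y = tmul B x (b * y) := by
  have h : (x * b) ⊗ₜ[k] y - x ⊗ₜ[k] (b * y) ∈ balancing B :=
    Submodule.subset_span ⟨x, y, b, hb, rfl⟩
  exact (Submodule.Quotient.eq (balancing B)).mpr h

variable {B} in
/-- A `B`-balanced `k`-bilinear map factors through `A ⊗_B A`. -/
def lift {M : Type*} [AddCommGroup M] [Module k M] (f : A →ₗ[k] A →ₗ[k] M)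
    (hf : ∀ x y, ∀ b ∈ B, f (x * b) y = f x (b * y)) : TensorSquare B →ₗ[k] M :=
  (balancing B).liftQ (TensorProduct.lift f) <| by
    rw [balancing, Submodule.span_le]
    rintro _ ⟨x, y, b, hb, rfl⟩
    simp [hf x y b hb]

@[simp] lemma lift_tmul {M : Type*} [AddCommGroup M] [Module k M] (f : A →ₗ[k] A →ₗ[k] M)
    (hf : ∀ x y, ∀ b ∈ B, f (x * b) y = f x (b * y)) (x y : A) :
    lift f hf (tmul B x y) = f x y :=
  TensorProduct.lift.tmul x y

/-- The `k`-bilinear map `(x, y) ↦ x ⊗_B y`. -/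
def tmulₗ : A →ₗ[k] A →ₗ[k] TensorSquare B := (TensorProduct.mk k A A).compr₂ (proj B)

@[simp] lemma tmulₗ_apply (x y : A) : tmulₗ B x y = tmul B x y := rfl

/-- Left multiplication `x ⊗ y ↦ a x ⊗ y`. -/
def leftMul (a : A) : TensorSquare B →ₗ[k] TensorSquare B :=
  lift (tmulₗ B ∘ₗ LinearMap.mulLeft k a) fun x y b hb => by
    simp [← mul_assoc, mul_tmul (a * x) y hb]

/-- Right multiplication `x ⊗ y ↦ x ⊗ y a`. -/
def rightMul (a : A) : TensorSquare B →ₗ[k] TensorSquare B :=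
  lift ((tmulₗ B).compl₂ (LinearMap.mulRight k a)) fun x y b hb => by
    simp [mul_assoc, mul_tmul x (y * a) hb]

@[simp] lemma leftMul_tmul (a x y : A) : leftMul B a (tmul B x y) = tmul B (a * x) y :=
  lift_tmul B _ _ x y

@[simp] lemma rightMul_tmul (a x y : A) : rightMul B a (tmul B x y) = tmul B x (y * a) :=
  lift_tmul B _ _ x y

lemma add_tmul (x x' y : A) : tmul B (x + x') y = tmul B x y + tmul B x' y := by
  simp [← tmulₗ_apply]

lemma tmul_add (x y y' : A) : tmul B x (y + y') = tmul B x y + tmul B x y' := by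
  simp [← tmulₗ_apply]

lemma zero_tmul (y : A) : tmul B 0 y = 0 := by simp [← tmulₗ_apply]

lemma tmul_zero (x : A) : tmul B x 0 = 0 := by simp [← tmulₗ_apply]

/-- The left `A`-module structure on `A ⊗_B A`: `a • (x ⊗ y) = a x ⊗ y`. -/
instance : Module A (TensorSquare B) where
  smul a t := leftMul B a t
  one_smul t := LinearMap.congr_fun (f := leftMul B 1) (g := LinearMap.id)
    (hom_ext fun x y => by simp) t
  mul_smul a a' t := LinearMap.congr_fun (f := leftMul B (a * a'))
    (g := leftMul B a ∘ₗ leftMul B a') (hom_ext fun x y => by simp [mul_assoc]) t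
  smul_zero a := map_zero (leftMul B a)
  smul_add a := map_add (leftMul B a)
  add_smul a a' t := LinearMap.congr_fun (f := leftMul B (a + a'))
    (g := leftMul B a + leftMul B a') (hom_ext fun x y => by simp [add_mul, add_tmul]) t
  zero_smul t := LinearMap.congr_fun (f := leftMul B 0) (g := 0)
    (hom_ext fun x y => by simp [zero_tmul]) t

/-- The right `A`-module structure on `A ⊗_B A`: `(x ⊗ y) a = x ⊗ y a`. -/
instance : Module Aᵐᵒᵖ (TensorSquare B) where
  smul a t := rightMul B a.unop t
  one_smul t := LinearMap.congr_fun (f := rightMul B 1) (g := LinearMap.id)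
    (hom_ext fun x y => by simp) t
  mul_smul a a' t := LinearMap.congr_fun (f := rightMul B (a'.unop * a.unop))
    (g := rightMul B a.unop ∘ₗ rightMul B a'.unop) (hom_ext fun x y => by simp [mul_assoc]) t
  smul_zero a := map_zero (rightMul B a.unop)
  smul_add a := map_add (rightMul B a.unop)
  add_smul a a' t := LinearMap.congr_fun (f := rightMul B (a.unop + a'.unop))
    (g := rightMul B a.unop + rightMul B a'.unop)
    (hom_ext fun x y => by simp [mul_add, tmul_add]) t
  zero_smul t := LinearMap.congr_fun (f := rightMul B 0) (g := 0)
    (hom_ext fun x y => by simp [tmul_zero]) t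

@[simp] lemma smul_tmul (a x y : A) : a • tmul B x y = tmul B (a * x) y := leftMul_tmul B a x y

@[simp] lemma op_smul_tmul (a x y : A) :
    MulOpposite.op a • tmul B x y = tmul B x (y * a) := rightMul_tmul B a x y

/-- The two actions of `A` commute: `A ⊗_B A` is an `A`-`A`-bimodule. -/
instance : SMulCommClass A Aᵐᵒᵖ (TensorSquare B) where
  smul_comm a a' t := LinearMap.congr_fun (f := leftMul B a ∘ₗ rightMul B a'.unop)
    (g := rightMul B a'.unop ∘ₗ leftMul B a) (hom_ext fun x y => by simp) t

end TensorSquare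

end TensorSquare

/-! ### Depth two extensions -/

section DepthTwo

variable {k A : Type*} [CommRing k] [Ring A] [Algebra k A]

section Summand

variable {M N : Type*} [AddCommGroup M] [Module k M] [Module A M] [Module Aᵐᵒᵖ M]
  [AddCommGroup N] [Module k N] [Module A N] [Module Aᵐᵒᵖ N]

/-- `P` is an `L`-`R`-subbimodule of the `A`-`A`-bimodule `N`: it is stable under the left action
of `L` and the right action of `R`. -/
def IsSubbimodule (L R : Subalgebra k A) (P : Submodule k N) : Prop :=
  (∀ a ∈ L, ∀ x ∈ P, a • x ∈ P) ∧ (∀ a ∈ R, ∀ x ∈ P, MulOpposite.op a • x ∈ P)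

variable (M N) in
/-- `M ⊕ * ≅ N` as `L`-`R`-bimodules: `M` is isomorphic, as an `L`-`R`-bimodule, to a direct
summand `P` (with complement `Q`) of the `L`-`R`-bimodule `N`. -/
def IsBimoduleSummand (L R : Subalgebra k A) : Prop :=
  ∃ P Q : Submodule k N, IsSubbimodule L R P ∧ IsSubbimodule L R Q ∧ IsCompl P Q ∧
    ∃ e : M ≃ₗ[k] P,
      (∀ a ∈ L, ∀ x : M, (e (a • x) : N) = a • (e x : N)) ∧
      (∀ a ∈ R, ∀ x : M, (e (MulOpposite.op a • x) : N) = MulOpposite.op a • (e x : N))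

end Summand

/-- Left depth two: `A ⊗_B A ⊕ * ≅ Aⁿ` as `B`-`A`-bimodules for some `n`. -/
def IsLeftDepthTwo (B : Subalgebra k A) : Prop :=
  ∃ n : ℕ, IsBimoduleSummand (TensorSquare B) (Fin n → A) B ⊤

/-- Right depth two: `A ⊗_B A ⊕ * ≅ Aⁿ` as `A`-`B`-bimodules for some `n`. -/
def IsRightDepthTwo (B : Subalgebra k A) : Prop :=
  ∃ n : ℕ, IsBimoduleSummand (TensorSquare B) (Fin n → A) ⊤ B

/-- The extension `A | B` is of depth two. -/
def IsDepthTwo (B : Subalgebra k A) : Prop :=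
  IsLeftDepthTwo B ∧ IsRightDepthTwo B

end DepthTwo

/-! ### Hopf-Galois extensions -/

section Galois

variable {k A C : Type*} [CommRing k] [Ring A] [Algebra k A] [Ring C] [HopfAlgebra k C]

/-- The algebra map `ρ : A → A ⊗ C` makes `A` a right `C`-comodule algebra: it is coassociative
and counital. -/
structure IsComoduleAlgebra (ρ : A →ₐ[k] A ⊗[k] C) : Prop where
  coassoc : (TensorProduct.assoc k A C C).toLinearMap ∘ₗ
      ρ.toLinearMap.rTensor C ∘ₗ ρ.toLinearMap =
    (Coalgebra.comul (R := k) (A := C)).lTensor A ∘ₗ ρ.toLinearMap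
  counit : (Coalgebra.counit (R := k) (A := C)).lTensor A ∘ₗ ρ.toLinearMap =
    (TensorProduct.mk k A k).flip 1

/-- The coinvariants `{a | ρ a = a ⊗ 1}`. -/
def coinvariants (ρ : A →ₐ[k] A ⊗[k] C) : Subalgebra k A :=
  AlgHom.equalizer ρ Algebra.TensorProduct.includeLeft

/-- The Galois map `β : A ⊗_B A → A ⊗ C`, `β (x ⊗ y) = (x ⊗ 1) ρ(y) = x y₀ ⊗ y₁`, where `B`
consists of coinvariants. -/
def galoisMap (ρ : A →ₐ[k] A ⊗[k] C) (B : Subalgebra k A) (hB : B ≤ coinvariants ρ) :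
    TensorSquare B →ₗ[k] A ⊗[k] C :=
  TensorSquare.lift
    ((LinearMap.mul k (A ⊗[k] C)).compl₁₂
      (Algebra.TensorProduct.includeLeft : A →ₐ[k] A ⊗[k] C).toLinearMap ρ.toLinearMap)
    fun x y b hb => by
      have h : ρ b = b ⊗ₜ[k] 1 := hB hb
      simp [h, ← mul_assoc]

lemma galoisMap_tmul (ρ : A →ₐ[k] A ⊗[k] C) (B : Subalgebra k A) (hB : B ≤ coinvariants ρ)
    (x y : A) : galoisMap ρ B hB (TensorSquare.tmul B x y) = (x ⊗ₜ[k] 1) * ρ y :=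
  TensorSquare.lift_tmul B _ _ x y

/-- With the coaction `ρ`, the extension `A | B` is (right) `C`-Galois: `A` is a right
`C`-comodule algebra, its subalgebra of coinvariants is `B`, and the Galois map
`A ⊗_B A → A ⊗ C` is bijective. -/
def IsGaloisExtension (ρ : A →ₐ[k] A ⊗[k] C) (B : Subalgebra k A) : Prop :=
  IsComoduleAlgebra ρ ∧
    ∃ h : coinvariants ρ = B, Function.Bijective (galoisMap ρ B h.ge)

end Galois

/-! ### Normal Hopf subalgebras -/

section Normal

variable {k H : Type*} [Field k] [Ring H] [HopfAlgebra k H]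

/-- A Hopf subalgebra: a subalgebra `K` with `Δ(K) ⊆ K ⊗ K` and `S(K) ⊆ K`. -/
structure IsHopfSubalgebra (K : Subalgebra k H) : Prop where
  comul_mem : ∀ x ∈ K, Coalgebra.comul (R := k) x ∈
    LinearMap.range (TensorProduct.map K.val.toLinearMap K.val.toLinearMap)
  antipode_mem : ∀ x ∈ K, HopfAlgebra.antipode k x ∈ K

/-- `a ↦ S(a₁) x a₂`. -/
def rightAdjoint (x : H) : H →ₗ[k] H :=
  LinearMap.mul' k H ∘ₗ
    TensorProduct.map (HopfAlgebra.antipode k) (LinearMap.mulLeft k x) ∘ₗ Coalgebra.comul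

/-- `a ↦ a₁ x S(a₂)`. -/
def leftAdjoint (x : H) : H →ₗ[k] H :=
  LinearMap.mul' k H ∘ₗ
    TensorProduct.map (LinearMap.mulRight k x) (HopfAlgebra.antipode k) ∘ₗ Coalgebra.comul

/-- `K` is a normal Hopf subalgebra of `H`: `S(a₁) x a₂ ∈ K` and `a₁ x S(a₂) ∈ K` for all
`a ∈ H` and `x ∈ K`. -/
structure IsNormalHopfSubalgebra (K : Subalgebra k H) : Prop extends IsHopfSubalgebra K where
  rightAdjoint_mem : ∀ x ∈ K, ∀ a : H, rightAdjoint (k := k) x a ∈ K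
  leftAdjoint_mem : ∀ x ∈ K, ∀ a : H, leftAdjoint (k := k) x a ∈ K

/-- The left ideal `H K⁺` of `H`, where `K⁺ = K ∩ ker ε`. -/
def augmentationIdeal (K : Subalgebra k H) : Ideal H :=
  Ideal.span {x | x ∈ K ∧ Coalgebra.counit (R := k) x = 0}

/-- The natural coaction `H → H ⊗ H/HK⁺`, `a ↦ a₁ ⊗ (a₂ + HK⁺)`. -/
def naturalCoaction (K : Subalgebra k H) [(augmentationIdeal K).IsTwoSided] :
    H →ₐ[k] H ⊗[k] (H ⧸ augmentationIdeal K) :=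
  (Algebra.TensorProduct.map (AlgHom.id k H) (Ideal.Quotient.mkₐ k (augmentationIdeal K))).comp
    (Bialgebra.comulAlgHom k H)

end Normal

end HopfDepthTwo

end

/-!
Let `I = HK⁺`. In the convolution algebra `Hom(H, H)` the map `a ↦ S(a₁) x a₂` is `S * L_x`, where
`L_x` is left multiplication by `x`, and `id * S = 1`; hence `x a = a₁ (S(a₂) x a₃)`, and likewise
`a x = (a₁ x S(a₂)) a₃`. By normality `HK⁺ = K⁺H`, so `I` is two-sided, and it is a Hopf ideal
since the projection `H → H/I` restricts to `ε` on `K` and `Δ(K) ⊆ K ⊗ K`.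

The Galois map has the inverse `x ⊗ ā ↦ x S(a₁) ⊗_K a₂`: the map `a ↦ S(a₁) ⊗_K a₂` vanishes on
`K⁺H` because `S(x₁)` can be moved across the tensor sign when `x ∈ K`. That the two maps are
mutually inverse is again an identity of convolution products, now in `H ⊗ H/I` and `H ⊗ H`.

An element `a` is coinvariant exactly if the Galois map identifies `1 ⊗_K a` with `a ⊗_K 1`. This
forces `a ∈ K` as soon as there is a left `K`-linear retraction `r : H → K`, which is applied to the
second factor (`IsHopfSubalgebra.mem_of_tmul_eq`). Such a retraction exists because a
finite-dimensional Hopf algebra is self-injective, and it can be written down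
(`IsHopfSubalgebra.exists_retraction`). Let `p` be a `k`-linear projection of `H` onto `K`, let
`(eᵢ)` be a basis of `K` with coordinates `cᵢ`, and put `F_h(x) = S(x₁) p(x₂ h)` and
`r(h) = ∑ᵢ F_h(eᵢ)₁ cᵢ(S(F_h(eᵢ)₂))`. Then `F_{ah}(x) = a₁ F_h(x a₂)` (`sum_mul_twist`), and a basis
expansion moves `a₂` inside the trace (`IsHopfSubalgebra.partialTrace_comp_mulRight`), so that
`r(ah) = a r(h)` for `a ∈ K`. Neither integrals nor freeness of `H` over `K` are needed.

The Galois map is `H`-linear on the left and `K`-linear on the right, so it identifies `H ⊗_K H`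
with a power of `H` as an `H`-`K`-bimodule; this is right depth two. Left depth two follows in the
same way from the map `x ⊗ y ↦ x̄₁ ⊗ x₂ y`, whose inverse `ā ⊗ y ↦ a₁ ⊗_K S(a₂) y` does not
involve the inverse of the antipode.
-/

noncomputable section

namespace HopfDepthTwo

open Coalgebra HopfAlgebra WithConv

/-! ### Convolution identities -/

section Convolution

variable {k H : Type*} [Field k] [Ring H] [HopfAlgebra k H]
  {E : Type*} [Ring E] [Algebra k E]

lemma comp_antipode_convMul (j : H →ₐ[k] E) :
    toConv (j.toLinearMap ∘ₗ antipode k) * toConv j.toLinearMap = 1 := by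
  have h := LinearMap.algHom_comp_convMul_distrib j (toConv (antipode k)) (toConv LinearMap.id)
  rw [LinearMap.antipode_mul_id] at h
  exact ofConv_injective (h.symm.trans (by ext; simp))

lemma convMul_comp_antipode (j : H →ₐ[k] E) :
    toConv j.toLinearMap * toConv (j.toLinearMap ∘ₗ antipode k) = 1 := by
  have h := LinearMap.algHom_comp_convMul_distrib j (toConv LinearMap.id) (toConv (antipode k))
  rw [LinearMap.id_mul_antipode] at h
  exact ofConv_injective (h.symm.trans (by ext; simp))

/-- `a₁ (S(a₂) x a₃) = x a`. -/
lemma sum_mul_rightAdjoint (x a : H) {ι : Type*} (r : Repr k a ι) :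
    ∑ i ∈ r.index, r.left i * rightAdjoint (k := k) x (r.right i) = x * a := by
  have h : toConv LinearMap.id * toConv (rightAdjoint (k := k) x) =
      toConv (LinearMap.mulLeft k x) := by
    change toConv LinearMap.id * (toConv (antipode k) * toConv (LinearMap.mulLeft k x)) = _
    rw [← mul_assoc, LinearMap.id_mul_antipode, one_mul]
  have := congr($h a)
  rwa [r.convMul_apply] at this

/-- `(a₁ x S(a₂)) a₃ = a x`. -/
lemma sum_leftAdjoint_mul (x a : H) {ι : Type*} (r : Repr k a ι) :
    ∑ i ∈ r.index, leftAdjoint (k := k) x (r.left i) * r.right i = a * x := by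
  have h : toConv (leftAdjoint (k := k) x) * toConv LinearMap.id =
      toConv (LinearMap.mulRight k x) := by
    change (toConv (LinearMap.mulRight k x) * toConv (antipode k)) * toConv LinearMap.id = _
    rw [mul_assoc, LinearMap.antipode_mul_id, mul_one]
  have := congr($h a)
  rwa [r.convMul_apply] at this

lemma sum_counit_mul_counit (a : H) {ι : Type*} (r : Repr k a ι) :
    ∑ i ∈ r.index, counit (R := k) (r.left i) * counit (R := k) (r.right i) =
      counit (R := k) a := by
  simpa using congr(counit (R := k) $(sum_counit_smul r))

lemma counit_rightAdjoint (x a : H) :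
    counit (R := k) (rightAdjoint (k := k) x a) = counit (R := k) x * counit (R := k) a := by
  rw [← sum_counit_mul_counit a (ℛ k a), Finset.mul_sum]
  simp [rightAdjoint, ← (ℛ k a).eq, mul_left_comm]

lemma counit_leftAdjoint (x a : H) :
    counit (R := k) (leftAdjoint (k := k) x a) = counit (R := k) x * counit (R := k) a := by
  rw [← sum_counit_mul_counit a (ℛ k a), Finset.mul_sum]
  simp [leftAdjoint, ← (ℛ k a).eq, mul_left_comm, mul_assoc]

end Convolution

/-! ### Hopf subalgebras -/

section HopfSubalgebra

variable {k H : Type*} [Field k] [Ring H] [HopfAlgebra k H] {K : Subalgebra k H}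

/-- Linear maps that agree on `K` have tensor products that agree on `Δ(K) ⊆ K ⊗ K`. -/
lemma IsHopfSubalgebra.map_comul_congr (hK : IsHopfSubalgebra K) {M N : Type*}
    [AddCommGroup M] [Module k M] [AddCommGroup N] [Module k N]
    {f f' : H →ₗ[k] M} {g g' : H →ₗ[k] N} (hf : ∀ x ∈ K, f x = f' x) (hg : ∀ x ∈ K, g x = g' x)
    {x : H} (hx : x ∈ K) :
    TensorProduct.map f g (comul x) = TensorProduct.map f' g' (comul x) := by
  obtain ⟨t, ht⟩ := hK.comul_mem x hx
  have h₁ : f ∘ₗ K.val.toLinearMap = f' ∘ₗ K.val.toLinearMap := by ext y; exact hf y y.2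
  have h₂ : g ∘ₗ K.val.toLinearMap = g' ∘ₗ K.val.toLinearMap := by ext y; exact hg y y.2
  rw [← ht, ← LinearMap.comp_apply, ← LinearMap.comp_apply, ← TensorProduct.map_comp,
    ← TensorProduct.map_comp, h₁, h₂]

/-- The comultiplication of `x ∈ K` can be written with tensor factors in `K`. -/
lemma IsHopfSubalgebra.exists_repr (hK : IsHopfSubalgebra K) {x : H} (hx : x ∈ K) :
    ∃ r : Repr k x (K × K), (∀ i, r.left i ∈ K) ∧ ∀ i, r.right i ∈ K := by
  obtain ⟨t, ht⟩ := hK.comul_mem x hx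
  obtain ⟨s, rfl⟩ := TensorProduct.exists_finset t
  exact ⟨⟨s, fun i => i.1, fun i => i.2, by simpa [map_sum] using ht⟩,
    fun i => i.1.2, fun i => i.2.2⟩

end HopfSubalgebra

/-! ### The Hopf ideal `HK⁺` of a normal Hopf subalgebra -/

section AugmentationIdeal

variable {k H : Type*} [Field k] [Ring H] [HopfAlgebra k H] {K : Subalgebra k H}

lemma mul_mem_augmentationIdeal (a : H) {x : H} (hx : x ∈ K) (hε : counit (R := k) x = 0) :
    a * x ∈ augmentationIdeal K :=
  Ideal.mul_mem_left _ _ (Ideal.subset_span ⟨hx, hε⟩)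

/-- `K⁺H ⊆ HK⁺`, by normality. -/
lemma IsNormalHopfSubalgebra.mul_mem_augmentationIdeal' (hK : IsNormalHopfSubalgebra K) (a : H)
    {x : H} (hx : x ∈ K) (hε : counit (R := k) x = 0) : x * a ∈ augmentationIdeal K := by
  rw [← sum_mul_rightAdjoint x a (ℛ k a)]
  refine sum_mem fun i _ => mul_mem_augmentationIdeal _ (hK.rightAdjoint_mem x hx _) ?_
  rw [counit_rightAdjoint, hε, zero_mul]

/-- Induction principle for the left ideal `HK⁺`. -/
lemma augmentationIdeal_induction {p : H → Prop} (zero : p 0) (add : ∀ y z, p y → p z → p (y + z))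
    (mul : ∀ a, ∀ x ∈ K, counit (R := k) x = 0 → p (a * x)) {z : H}
    (hz : z ∈ augmentationIdeal K) : p z := by
  exact Submodule.closure_induction (p := fun z _ => p z) zero (fun y z _ _ => add y z)
    (fun a x hx => mul a x hx.1 hx.2) hz

lemma IsNormalHopfSubalgebra.isTwoSided (hK : IsNormalHopfSubalgebra K) :
    (augmentationIdeal K).IsTwoSided where
  mul_mem_of_left b h := by
    refine augmentationIdeal_induction (p := fun z => z * b ∈ augmentationIdeal K) (by simp)
      (fun y z hy hz => by rw [add_mul]; exact add_mem hy hz) (fun a x hx hε => ?_) h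
    rw [mul_assoc]
    exact Ideal.mul_mem_left _ _ (hK.mul_mem_augmentationIdeal' b hx hε)

/-- `HK⁺ = K⁺H`, in the form of an induction principle. -/
lemma IsNormalHopfSubalgebra.augmentationIdeal_induction' (hK : IsNormalHopfSubalgebra K)
    {p : H → Prop} (zero : p 0) (add : ∀ y z, p y → p z → p (y + z))
    (mul : ∀ a, ∀ x ∈ K, counit (R := k) x = 0 → p (x * a)) {z : H}
    (hz : z ∈ augmentationIdeal K) : p z := by
  refine augmentationIdeal_induction zero add (fun a x hx hε => ?_) hz
  rw [← sum_leftAdjoint_mul x a (ℛ k a)]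
  refine Finset.sum_induction _ p add zero fun i _ => mul _ _ (hK.leftAdjoint_mem x hx _) ?_
  rw [counit_leftAdjoint, hε, zero_mul]

/-- Right multiplication by `x ∈ K` becomes multiplication by `ε(x)` modulo `HK⁺`. -/
lemma mk_mul_of_mem (a : H) {x : H} (hx : x ∈ K) :
    Submodule.Quotient.mk (p := augmentationIdeal K) (a * x) =
      counit (R := k) x • Submodule.Quotient.mk a := by
  rw [← Submodule.Quotient.mk_smul, Submodule.Quotient.eq]
  have := mul_mem_augmentationIdeal (k := k) (K := K) a
    (x := x - algebraMap k H (counit (R := k) x)) (sub_mem hx (K.algebraMap_mem _)) (by simp)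
  rwa [mul_sub, ← Algebra.commutes, ← Algebra.smul_def] at this

/-- The projection `H → H/HK⁺` restricts to the counit on `K`. -/
lemma mk_eq_counit [(augmentationIdeal K).IsTwoSided] {x : H} (hx : x ∈ K) :
    (Ideal.Quotient.mkₐ k (augmentationIdeal K)).toLinearMap x =
      (Algebra.linearMap k _ ∘ₗ counit) x := by
  have := mk_mul_of_mem (k := k) (1 : H) hx
  rw [one_mul] at this
  exact this.trans (Algebra.algebraMap_eq_smul_one _).symm

lemma IsNormalHopfSubalgebra.isHopfIdeal (hK : IsNormalHopfSubalgebra K) :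
    (augmentationIdeal K).IsHopfIdeal k where
  counit_eq_zero z hz := by
    refine augmentationIdeal_induction (p := fun z => counit (R := k) z = 0) (by simp)
      (fun y z hy hz => by rw [map_add, hy, hz, add_zero]) (fun a x hx hε => ?_) hz
    rw [Bialgebra.counit_mul, hε, mul_zero]
  map_mkQ_comul_eq_zero z hz := by
    have := hK.isTwoSided
    let π := Ideal.Quotient.mkₐ k (augmentationIdeal K)
    let ψ := (Algebra.TensorProduct.map π π).comp (Bialgebra.comulAlgHom k H)
    refine augmentationIdeal_induction (p := fun z => ψ z = 0) (by simp)
      (fun y z hy hz => by rw [map_add, hy, hz, add_zero]) (fun a x hx hε => ?_) hz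
    -- on `Δ(x) ∈ K ⊗ K` the projection acts as `ε ⊗ ε`, so that `x` maps to `ε(x) = 0`
    have hx' : ψ x = 0 := by
      refine (hK.map_comul_congr (fun _ => mk_eq_counit) (fun _ => mk_eq_counit) hx).trans ?_
      have := congr(TensorProduct.map (Algebra.linearMap k (H ⧸ augmentationIdeal K))
        (Algebra.linearMap k (H ⧸ augmentationIdeal K) ∘ₗ counit)
        $(rTensor_counit_comul (R := k) x))
      rw [LinearMap.rTensor, ← LinearMap.comp_apply, ← TensorProduct.map_comp] at this
      simpa [hε] using this
    rw [map_mul, hx', mul_zero]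
  antipode_mem z hz := by
    have := hK.isTwoSided
    refine augmentationIdeal_induction (p := fun z => antipode k z ∈ augmentationIdeal K)
      (by simp) (fun y z hy hz => by rw [map_add]; exact add_mem hy hz) (fun a x hx hε => ?_) hz
    rw [antipode_mul_antidistrib]
    exact hK.mul_mem_augmentationIdeal' _ (hK.antipode_mem x hx) (by simpa using hε)

end AugmentationIdeal

/-! ### The Galois map and its left-handed version -/

section TensorSquareScalars

variable {k A : Type*} [CommRing k] [Ring A] [Algebra k A] (B : Subalgebra k A)

instance : IsScalarTower k A (TensorSquare B) where
  smul_assoc r a t := LinearMap.congr_fun (f := TensorSquare.leftMul B (r • a))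
    (g := r • TensorSquare.leftMul B a) (TensorSquare.hom_ext fun x y => by
      rw [TensorSquare.leftMul_tmul, LinearMap.smul_apply, TensorSquare.leftMul_tmul,
        smul_mul_assoc, ← TensorSquare.tmulₗ_apply, map_smul]; rfl) t

instance : SMulCommClass k A (TensorSquare B) where
  smul_comm r a t := ((TensorSquare.leftMul B a).map_smul r t).symm

instance : SMulCommClass k Aᵐᵒᵖ (TensorSquare B) where
  smul_comm r a t := ((TensorSquare.rightMul B a.unop).map_smul r t).symm

instance : IsScalarTower k Aᵐᵒᵖ (TensorSquare B) where
  smul_assoc r a t := LinearMap.congr_fun (f := TensorSquare.rightMul B (r • a.unop))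
    (g := r • TensorSquare.rightMul B a.unop) (TensorSquare.hom_ext fun x y => by
      rw [TensorSquare.rightMul_tmul, LinearMap.smul_apply, TensorSquare.rightMul_tmul,
        mul_smul_comm, ← TensorSquare.tmulₗ_apply, map_smul]; rfl) t

lemma TensorSquare.smul_proj (a : A) (z : A ⊗[k] A) :
    a • TensorSquare.proj B z = TensorSquare.proj B ((a ⊗ₜ 1) * z) := by
  induction z with
  | zero => simp
  | add y z hy hz => rw [map_add, smul_add, hy, hz, mul_add, map_add]
  | tmul x y =>
    rw [Algebra.TensorProduct.tmul_mul_tmul, one_mul]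
    exact TensorSquare.smul_tmul B a x y

lemma TensorSquare.op_smul_proj (a : A) (z : A ⊗[k] A) :
    MulOpposite.op a • TensorSquare.proj B z = TensorSquare.proj B (z * (1 ⊗ₜ a)) := by
  induction z with
  | zero => simp
  | add y z hy hz => rw [map_add, smul_add, hy, hz, add_mul, map_add]
  | tmul x y =>
    rw [Algebra.TensorProduct.tmul_mul_tmul, mul_one]
    exact TensorSquare.op_smul_tmul B a x y

end TensorSquareScalars

section TensorMul

variable {k H C D : Type*} [Field k] [Ring H] [HopfAlgebra k H] [Ring C] [Algebra k C]
  [Ring D] [Algebra k D]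

/-- `a ↦ f(a₁) ⊗ g(a₂)` as the convolution product of `f` and `g` in the algebra `C ⊗ D`. -/
lemma includeLeft_convMul_includeRight (f : H →ₗ[k] C) (g : H →ₗ[k] D) :
    toConv ((Algebra.TensorProduct.includeLeft : C →ₐ[k] C ⊗[k] D).toLinearMap ∘ₗ f) *
      toConv ((Algebra.TensorProduct.includeRight : D →ₐ[k] C ⊗[k] D).toLinearMap ∘ₗ g) =
    toConv (TensorProduct.map f g ∘ₗ comul) := by
  ext a
  simp [← (ℛ k a).eq]

end TensorMul

section Galois

variable {k H : Type*} [Field k] [Ring H] [HopfAlgebra k H] {K : Subalgebra k H}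

variable (K) in
/-- The map `a ↦ S(a₁) ⊗_K a₂`. -/
def translationMap : H →ₗ[k] TensorSquare K :=
  TensorSquare.proj K ∘ₗ TensorProduct.map (antipode k) LinearMap.id ∘ₗ comul

variable (K) in
/-- The map `a ↦ a₁ ⊗_K S(a₂)`. -/
def leftTranslationMap : H →ₗ[k] TensorSquare K :=
  TensorSquare.proj K ∘ₗ TensorProduct.map LinearMap.id (antipode k) ∘ₗ comul

lemma IsHopfSubalgebra.translationMap_mul (hK : IsHopfSubalgebra K) {x : H} (hx : x ∈ K) (a : H) :
    translationMap K (x * a) = counit (R := k) x • translationMap K a := by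
  obtain ⟨r, hl, hr⟩ := hK.exists_repr hx
  -- `S(a₁) S(x₁) ⊗ x₂ a₂ = S(a₁) S(x₁) x₂ ⊗ a₂`
  have key : ∀ b c : H, ∑ i ∈ r.index, TensorSquare.tmul K (antipode k (r.left i * b))
      (r.right i * c) = counit (R := k) x • TensorSquare.tmul K (antipode k b) c := fun b c => by
    simp_rw [antipode_mul_antidistrib, ← TensorSquare.mul_tmul _ _ (hr _), mul_assoc,
      ← TensorSquare.tmulₗ_apply]
    rw [← LinearMap.sum_apply, ← map_sum, ← Finset.mul_sum, sum_antipode_mul_eq_smul]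
    simp
  simp only [translationMap, LinearMap.comp_apply, Bialgebra.comul_mul, ← r.eq, ← (ℛ k a).eq,
    Finset.sum_mul_sum, map_sum, Algebra.TensorProduct.tmul_mul_tmul, TensorProduct.map_tmul,
    Finset.smul_sum]
  rw [Finset.sum_comm]
  exact Finset.sum_congr rfl fun j _ => key _ _

lemma IsHopfSubalgebra.leftTranslationMap_mul (hK : IsHopfSubalgebra K) (a : H) {x : H}
    (hx : x ∈ K) :
    leftTranslationMap K (a * x) = counit (R := k) x • leftTranslationMap K a := by
  obtain ⟨r, hl, hr⟩ := hK.exists_repr hx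
  -- `a₁ x₁ ⊗ S(x₂) S(a₂) = a₁ x₁ S(x₂) ⊗ S(a₂)`
  have key : ∀ b c : H, ∑ i ∈ r.index, TensorSquare.tmul K (b * r.left i)
      (antipode k (c * r.right i)) = counit (R := k) x • TensorSquare.tmul K b (antipode k c) :=
    fun b c => by
    simp_rw [antipode_mul_antidistrib, ← TensorSquare.mul_tmul _ _ (hK.antipode_mem _ (hr _)),
      mul_assoc, ← TensorSquare.tmulₗ_apply]
    rw [← LinearMap.sum_apply, ← map_sum, ← Finset.mul_sum, sum_mul_antipode_eq_smul]
    simp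
  simp only [leftTranslationMap, LinearMap.comp_apply, Bialgebra.comul_mul, ← r.eq, ← (ℛ k a).eq,
    Finset.sum_mul_sum, map_sum, Algebra.TensorProduct.tmul_mul_tmul, TensorProduct.map_tmul,
    Finset.smul_sum]
  exact Finset.sum_congr rfl fun j _ => key _ _

/-- The map `ā ↦ S(a₁) ⊗_K a₂` on `H/HK⁺`; it is well defined because `HK⁺ = K⁺H`. -/
def IsNormalHopfSubalgebra.translationMapQuot (hK : IsNormalHopfSubalgebra K) :
    (H ⧸ augmentationIdeal K) →ₗ[k] TensorSquare K :=
  ((augmentationIdeal K).restrictScalars k).liftQ (translationMap K) fun _ hz =>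
    hK.augmentationIdeal_induction' (p := fun z => translationMap K z = 0) (map_zero _)
      (fun y z hy hz => by rw [map_add, hy, hz, add_zero])
      (fun a x hx hε => by rw [hK.translationMap_mul hx, hε, zero_smul]) hz

/-- The map `ā ↦ a₁ ⊗_K S(a₂)` on `H/HK⁺`. -/
def IsHopfSubalgebra.leftTranslationMapQuot (hK : IsHopfSubalgebra K) :
    (H ⧸ augmentationIdeal K) →ₗ[k] TensorSquare K :=
  ((augmentationIdeal K).restrictScalars k).liftQ (leftTranslationMap K) fun _ hz =>
    augmentationIdeal_induction (p := fun z => leftTranslationMap K z = 0) (map_zero _)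
      (fun y z hy hz => by rw [map_add, hy, hz, add_zero])
      (fun a x hx hε => by rw [hK.leftTranslationMap_mul a hx, hε, zero_smul]) hz

/-- The inverse `x ⊗ ā ↦ x S(a₁) ⊗_K a₂` of the Galois map. -/
def IsNormalHopfSubalgebra.galoisInv (hK : IsNormalHopfSubalgebra K) :
    H ⊗[k] (H ⧸ augmentationIdeal K) →ₗ[k] TensorSquare K :=
  TensorProduct.lift <| LinearMap.mk₂ k (fun x c => x • hK.translationMapQuot c)
    (fun _ _ _ => add_smul _ _ _) (fun _ _ _ => smul_assoc _ _ _)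
    (fun _ _ _ => by rw [map_add, smul_add]) fun r x c => by rw [map_smul, smul_comm]

/-- The map `ā ⊗ y ↦ a₁ ⊗_K S(a₂) y`. -/
def IsHopfSubalgebra.leftGaloisInv (hK : IsHopfSubalgebra K) :
    (H ⧸ augmentationIdeal K) ⊗[k] H →ₗ[k] TensorSquare K :=
  TensorProduct.lift <| LinearMap.mk₂ k (fun c y => MulOpposite.op y • hK.leftTranslationMapQuot c)
    (fun _ _ _ => by rw [map_add, smul_add]) (fun r x c => by rw [map_smul, smul_comm])
    (fun _ _ _ => by rw [MulOpposite.op_add, add_smul])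
    (fun _ _ _ => by rw [MulOpposite.op_smul, smul_assoc])

variable [(augmentationIdeal K).IsTwoSided]

variable (K) in
/-- The left coaction `a ↦ ā₁ ⊗ a₂`. -/
def leftCoaction : H →ₐ[k] (H ⧸ augmentationIdeal K) ⊗[k] H :=
  (Algebra.TensorProduct.map (Ideal.Quotient.mkₐ k (augmentationIdeal K)) (AlgHom.id k H)).comp
    (Bialgebra.comulAlgHom k H)

lemma naturalCoaction_apply (a : H) :
    naturalCoaction K a = TensorProduct.map LinearMap.id
      (Ideal.Quotient.mkₐ k (augmentationIdeal K)).toLinearMap (comul a) := rfl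

lemma leftCoaction_apply (a : H) :
    leftCoaction K a = TensorProduct.map (Ideal.Quotient.mkₐ k (augmentationIdeal K)).toLinearMap
      LinearMap.id (comul a) := rfl

lemma IsHopfSubalgebra.leftGaloisInv_mk_tmul (hK : IsHopfSubalgebra K) (a y : H) :
    hK.leftGaloisInv (Ideal.Quotient.mkₐ k (augmentationIdeal K) a ⊗ₜ y) =
      MulOpposite.op y • leftTranslationMap K a := rfl

lemma IsNormalHopfSubalgebra.galoisInv_tmul_mk (hK : IsNormalHopfSubalgebra K) (x a : H) :
    hK.galoisInv (x ⊗ₜ Ideal.Quotient.mkₐ k (augmentationIdeal K) a) =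
      x • translationMap K a := rfl

lemma IsHopfSubalgebra.naturalCoaction_of_mem (hK : IsHopfSubalgebra K) {x : H} (hx : x ∈ K) :
    naturalCoaction K x = x ⊗ₜ 1 := by
  rw [naturalCoaction_apply, hK.map_comul_congr (f := LinearMap.id) (f' := LinearMap.id)
    (fun _ _ => rfl) (fun _ => mk_eq_counit) hx]
  have := congr(TensorProduct.map LinearMap.id
    (Algebra.linearMap k (H ⧸ augmentationIdeal K)) $(lTensor_counit_comul (R := k) x))
  rw [LinearMap.lTensor, ← LinearMap.comp_apply, ← TensorProduct.map_comp] at this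
  simpa using this

lemma IsHopfSubalgebra.leftCoaction_of_mem (hK : IsHopfSubalgebra K) {x : H} (hx : x ∈ K) :
    leftCoaction K x = 1 ⊗ₜ x := by
  rw [leftCoaction_apply, hK.map_comul_congr (g := LinearMap.id) (g' := LinearMap.id)
    (fun _ => mk_eq_counit) (fun _ _ => rfl) hx]
  have := congr(TensorProduct.map (Algebra.linearMap k (H ⧸ augmentationIdeal K))
    LinearMap.id $(rTensor_counit_comul (R := k) x))
  rw [LinearMap.rTensor, ← LinearMap.comp_apply, ← TensorProduct.map_comp] at this
  simpa using this

lemma naturalCoaction_eq_convMul :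
    toConv (naturalCoaction K).toLinearMap =
      toConv (Algebra.TensorProduct.includeLeft : H →ₐ[k] _).toLinearMap *
      toConv (Algebra.TensorProduct.includeRight.toLinearMap ∘ₗ
        (Ideal.Quotient.mkₐ k (augmentationIdeal K)).toLinearMap) := by
  have := includeLeft_convMul_includeRight (LinearMap.id : H →ₗ[k] H)
    (Ideal.Quotient.mkₐ k (augmentationIdeal K)).toLinearMap
  rw [LinearMap.comp_id] at this
  exact this.symm

lemma leftCoaction_eq_convMul :
    toConv (leftCoaction K).toLinearMap =
      toConv (Algebra.TensorProduct.includeLeft.toLinearMap ∘ₗ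
        (Ideal.Quotient.mkₐ k (augmentationIdeal K)).toLinearMap) *
      toConv (Algebra.TensorProduct.includeRight : H →ₐ[k] _).toLinearMap := by
  have := includeLeft_convMul_includeRight
    (Ideal.Quotient.mkₐ k (augmentationIdeal K)).toLinearMap (LinearMap.id : H →ₗ[k] H)
  rw [LinearMap.comp_id] at this
  exact this.symm

/-- The left-handed Galois map `x ⊗_K y ↦ x̄₁ ⊗ x₂ y`. -/
def IsHopfSubalgebra.leftGaloisMap (hK : IsHopfSubalgebra K) :
    TensorSquare K →ₗ[k] (H ⧸ augmentationIdeal K) ⊗[k] H :=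
  TensorSquare.lift
    ((LinearMap.mul k ((H ⧸ augmentationIdeal K) ⊗[k] H)).compl₁₂ (leftCoaction K).toLinearMap
      (Algebra.TensorProduct.includeRight : H →ₐ[k] _).toLinearMap)
    fun x y b hb => by
      simp [hK.leftCoaction_of_mem hb, mul_assoc]

lemma IsHopfSubalgebra.leftGaloisMap_tmul (hK : IsHopfSubalgebra K) (x y : H) :
    hK.leftGaloisMap (TensorSquare.tmul K x y) = leftCoaction K x * (1 ⊗ₜ y) :=
  TensorSquare.lift_tmul K _ _ x y

lemma IsHopfSubalgebra.leftGaloisMap_smul (hK : IsHopfSubalgebra K) (a : H) (t : TensorSquare K) :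
    hK.leftGaloisMap (a • t) = leftCoaction K a * hK.leftGaloisMap t :=
  LinearMap.congr_fun (f := hK.leftGaloisMap ∘ₗ TensorSquare.leftMul K a)
    (g := LinearMap.mulLeft k (leftCoaction K a) ∘ₗ hK.leftGaloisMap)
    (TensorSquare.hom_ext fun x y => by simp [hK.leftGaloisMap_tmul, mul_assoc]) t

lemma IsHopfSubalgebra.leftGaloisMap_op_smul (hK : IsHopfSubalgebra K) (a : H)
    (t : TensorSquare K) :
    hK.leftGaloisMap (MulOpposite.op a • t) = hK.leftGaloisMap t * (1 ⊗ₜ a) :=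
  LinearMap.congr_fun (f := hK.leftGaloisMap ∘ₗ TensorSquare.rightMul K a)
    (g := LinearMap.mulRight k (1 ⊗ₜ a) ∘ₗ hK.leftGaloisMap)
    (TensorSquare.hom_ext fun x y => by simp [hK.leftGaloisMap_tmul, mul_assoc]) t

lemma IsHopfSubalgebra.leftGaloisMap_leftTranslationMap (hK : IsHopfSubalgebra K) (a : H) :
    hK.leftGaloisMap (leftTranslationMap K a) = Ideal.Quotient.mkₐ k _ a ⊗ₜ 1 := by
  have h : toConv (leftCoaction K).toLinearMap * toConv
      ((Algebra.TensorProduct.includeRight : H →ₐ[k] _).toLinearMap ∘ₗ antipode k) =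
      toConv (Algebra.TensorProduct.includeLeft.toLinearMap ∘ₗ
        (Ideal.Quotient.mkₐ k (augmentationIdeal K)).toLinearMap) := by
    rw [leftCoaction_eq_convMul, mul_assoc, convMul_comp_antipode, mul_one]
  refine Eq.trans ?_ congr($h a)
  simp only [leftTranslationMap, LinearMap.comp_apply, ← (ℛ k a).eq, map_sum,
    TensorProduct.map_tmul, (ℛ k a).convMul_apply]
  exact Finset.sum_congr rfl fun i _ => hK.leftGaloisMap_tmul _ _

lemma IsHopfSubalgebra.leftGaloisInv_leftCoaction (hK : IsHopfSubalgebra K) (a : H) :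
    hK.leftGaloisInv (leftCoaction K a) = TensorSquare.tmul K a 1 := by
  have h : toConv (TensorProduct.map LinearMap.id (antipode k) ∘ₗ comul) *
      toConv (Algebra.TensorProduct.includeRight : H →ₐ[k] H ⊗[k] H).toLinearMap =
      toConv (Algebra.TensorProduct.includeLeft : H →ₐ[k] H ⊗[k] H).toLinearMap := by
    rw [← includeLeft_convMul_includeRight, LinearMap.comp_id, mul_assoc, comp_antipode_convMul,
      mul_one]
  have h' : ∑ i ∈ (ℛ k a).index, TensorProduct.map LinearMap.id (antipode k)
      (comul ((ℛ k a).left i)) * (1 ⊗ₜ (ℛ k a).right i) = a ⊗ₜ[k] (1 : H) :=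
    ((ℛ k a).convMul_apply _ _).symm.trans congr($h a)
  rw [leftCoaction_apply, ← (ℛ k a).eq, TensorSquare.tmul, ← h', map_sum, map_sum, map_sum]
  refine Finset.sum_congr rfl fun i _ => ?_
  rw [← TensorSquare.op_smul_proj]
  exact hK.leftGaloisInv_mk_tmul _ _

lemma IsHopfSubalgebra.leftGaloisInv_mul (hK : IsHopfSubalgebra K)
    (z : (H ⧸ augmentationIdeal K) ⊗[k] H) (a : H) :
    hK.leftGaloisInv (z * (1 ⊗ₜ a)) = MulOpposite.op a • hK.leftGaloisInv z := by
  induction z with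
  | zero => simp
  | add y z hy hz => rw [add_mul, map_add, hy, hz, map_add, smul_add]
  | tmul x y => simp [leftGaloisInv, mul_smul]

/-- The left-handed Galois map is bijective, with inverse `ā ⊗ y ↦ a₁ ⊗_K S(a₂) y`. -/
def IsHopfSubalgebra.leftGaloisEquiv (hK : IsHopfSubalgebra K) :
    TensorSquare K ≃ₗ[k] (H ⧸ augmentationIdeal K) ⊗[k] H :=
  LinearEquiv.ofLinearMap hK.leftGaloisMap hK.leftGaloisInv
    (TensorProduct.ext' fun c y => by
      obtain ⟨a, rfl⟩ := Ideal.Quotient.mkₐ_surjective k (augmentationIdeal K) c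
      refine (hK.leftGaloisMap_op_smul y (leftTranslationMap K a)).trans ?_
      simp [hK.leftGaloisMap_leftTranslationMap])
    (TensorSquare.hom_ext fun x y => by
      simp [hK.leftGaloisMap_tmul, hK.leftGaloisInv_mul, hK.leftGaloisInv_leftCoaction])

lemma IsNormalHopfSubalgebra.galoisInv_naturalCoaction (hK : IsNormalHopfSubalgebra K) (a : H) :
    hK.galoisInv (naturalCoaction K a) = TensorSquare.tmul K 1 a := by
  have h : toConv (Algebra.TensorProduct.includeLeft : H →ₐ[k] H ⊗[k] H).toLinearMap *
      toConv (TensorProduct.map (antipode k) LinearMap.id ∘ₗ comul) =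
      toConv (Algebra.TensorProduct.includeRight : H →ₐ[k] H ⊗[k] H).toLinearMap := by
    rw [← includeLeft_convMul_includeRight, LinearMap.comp_id, ← mul_assoc,
      convMul_comp_antipode, one_mul]
  have h' : ∑ i ∈ (ℛ k a).index, ((ℛ k a).left i ⊗ₜ 1) * TensorProduct.map (antipode k)
      LinearMap.id (comul ((ℛ k a).right i)) = (1 : H) ⊗ₜ[k] a :=
    ((ℛ k a).convMul_apply _ _).symm.trans congr($h a)
  rw [naturalCoaction_apply, ← (ℛ k a).eq, TensorSquare.tmul, ← h', map_sum, map_sum, map_sum]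
  refine Finset.sum_congr rfl fun i _ => ?_
  rw [← TensorSquare.smul_proj]
  exact hK.galoisInv_tmul_mk _ _

lemma IsNormalHopfSubalgebra.galoisInv_mul (hK : IsNormalHopfSubalgebra K) (a : H)
    (z : H ⊗[k] (H ⧸ augmentationIdeal K)) :
    hK.galoisInv ((a ⊗ₜ 1) * z) = a • hK.galoisInv z := by
  induction z with
  | zero => simp
  | add y z hy hz => rw [mul_add, map_add, hy, hz, map_add, smul_add]
  | tmul x y => simp [galoisInv, mul_smul]

variable [(augmentationIdeal K).IsHopfIdeal k]

lemma IsHopfSubalgebra.le_coinvariants (hK : IsHopfSubalgebra K) :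
    K ≤ coinvariants (C := H ⧸ augmentationIdeal K) (naturalCoaction K) :=
  fun _ hx => hK.naturalCoaction_of_mem hx

lemma galoisMap_smul (h : K ≤ coinvariants (C := H ⧸ augmentationIdeal K) (naturalCoaction K))
    (a : H) (t : TensorSquare K) :
    galoisMap (C := H ⧸ augmentationIdeal K) (naturalCoaction K) K h (a • t) =
      (a ⊗ₜ 1) * galoisMap (C := H ⧸ augmentationIdeal K) (naturalCoaction K) K h t :=
  LinearMap.congr_fun
    (f := galoisMap (C := H ⧸ augmentationIdeal K) (naturalCoaction K) K h ∘ₗ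
      TensorSquare.leftMul K a)
    (g := LinearMap.mulLeft k (a ⊗ₜ 1) ∘ₗ
      galoisMap (C := H ⧸ augmentationIdeal K) (naturalCoaction K) K h)
    (TensorSquare.hom_ext fun x y => by simp [galoisMap_tmul, ← mul_assoc]) t

lemma galoisMap_op_smul (h : K ≤ coinvariants (C := H ⧸ augmentationIdeal K) (naturalCoaction K))
    (a : H) (t : TensorSquare K) :
    galoisMap (C := H ⧸ augmentationIdeal K) (naturalCoaction K) K h (MulOpposite.op a • t) =
      galoisMap (C := H ⧸ augmentationIdeal K) (naturalCoaction K) K h t * naturalCoaction K a :=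
  LinearMap.congr_fun
    (f := galoisMap (C := H ⧸ augmentationIdeal K) (naturalCoaction K) K h ∘ₗ
      TensorSquare.rightMul K a)
    (g := LinearMap.mulRight k (naturalCoaction K a) ∘ₗ
      galoisMap (C := H ⧸ augmentationIdeal K) (naturalCoaction K) K h)
    (TensorSquare.hom_ext fun x y => by simp [galoisMap_tmul, mul_assoc]) t

lemma galoisMap_translationMap
    (h : K ≤ coinvariants (C := H ⧸ augmentationIdeal K) (naturalCoaction K)) (a : H) :
    galoisMap (C := H ⧸ augmentationIdeal K) (naturalCoaction K) K h (translationMap K a) =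
      1 ⊗ₜ Ideal.Quotient.mkₐ k _ a := by
  have h : toConv
      ((Algebra.TensorProduct.includeLeft : H →ₐ[k] _).toLinearMap ∘ₗ antipode k) *
      toConv (naturalCoaction K).toLinearMap =
      toConv (Algebra.TensorProduct.includeRight.toLinearMap ∘ₗ
        (Ideal.Quotient.mkₐ k (augmentationIdeal K)).toLinearMap) := by
    rw [naturalCoaction_eq_convMul, ← mul_assoc, comp_antipode_convMul, one_mul]
  refine Eq.trans ?_ congr($h a)
  simp only [translationMap, LinearMap.comp_apply, ← (ℛ k a).eq, map_sum,
    TensorProduct.map_tmul, (ℛ k a).convMul_apply]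
  exact Finset.sum_congr rfl fun i _ => galoisMap_tmul _ _ _ _ _

/-- The Galois map is bijective, with inverse `x ⊗ ā ↦ x S(a₁) ⊗_K a₂`. -/
def IsNormalHopfSubalgebra.galoisEquiv (hK : IsNormalHopfSubalgebra K)
    (h : K ≤ coinvariants (C := H ⧸ augmentationIdeal K) (naturalCoaction K)) :
    TensorSquare K ≃ₗ[k] H ⊗[k] (H ⧸ augmentationIdeal K) :=
  LinearEquiv.ofLinearMap (galoisMap (C := H ⧸ augmentationIdeal K) (naturalCoaction K) K h)
    hK.galoisInv
    (TensorProduct.ext' fun y c => by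
      obtain ⟨a, rfl⟩ := Ideal.Quotient.mkₐ_surjective k (augmentationIdeal K) c
      refine (galoisMap_smul h y (translationMap K a)).trans ?_
      simp [galoisMap_translationMap])
    (TensorSquare.hom_ext fun x y => by
      simp [galoisMap_tmul, hK.galoisInv_mul, hK.galoisInv_naturalCoaction])

lemma isComoduleAlgebra_naturalCoaction :
    IsComoduleAlgebra (C := H ⧸ augmentationIdeal K) (naturalCoaction K) where
  coassoc := by
    let π := (Ideal.Quotient.mkₐ k (augmentationIdeal K)).toLinearMap
    have hρ : (naturalCoaction K).toLinearMap = TensorProduct.map LinearMap.id π ∘ₗ comul := rfl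
    have hπ : comul ∘ₗ π = TensorProduct.map π π ∘ₗ comul := rfl
    calc (TensorProduct.assoc k H _ _).toLinearMap ∘ₗ
          (naturalCoaction K).toLinearMap.rTensor _ ∘ₗ (naturalCoaction K).toLinearMap
        = ((TensorProduct.assoc k H _ _).toLinearMap ∘ₗ
            TensorProduct.map (TensorProduct.map LinearMap.id π) π) ∘ₗ comul.rTensor H ∘ₗ comul := by
          rw [hρ, LinearMap.rTensor, LinearMap.rTensor]
          simp only [LinearMap.comp_assoc]
          rw [← LinearMap.comp_assoc _ _ (TensorProduct.map (TensorProduct.map _ _) _),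
            ← LinearMap.comp_assoc _ _ (TensorProduct.map (_ ∘ₗ _) _),
            ← TensorProduct.map_comp, ← TensorProduct.map_comp]
          simp
      _ = TensorProduct.map LinearMap.id (TensorProduct.map π π) ∘ₗ comul.lTensor H ∘ₗ comul := by
          rw [← TensorProduct.map_map_comp_assoc_eq, LinearMap.comp_assoc, coassoc]
      _ = (comul (R := k)).lTensor H ∘ₗ (naturalCoaction K).toLinearMap := by
          rw [hρ, LinearMap.lTensor, LinearMap.lTensor, ← LinearMap.comp_assoc,
            ← LinearMap.comp_assoc, ← TensorProduct.map_comp, ← TensorProduct.map_comp, hπ]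
  counit := by
    let π := (Ideal.Quotient.mkₐ k (augmentationIdeal K)).toLinearMap
    have hρ : (naturalCoaction K).toLinearMap = TensorProduct.map LinearMap.id π ∘ₗ comul := rfl
    have hπ : counit ∘ₗ π = counit (R := k) (A := H) := rfl
    rw [hρ, LinearMap.lTensor, ← LinearMap.comp_assoc, ← TensorProduct.map_comp, hπ]
    exact lTensor_counit_comp_comul

end Galois

/-! ### A `K`-linear retraction of a Hopf algebra onto a finite-dimensional Hopf subalgebra -/

section Retraction

variable {k H : Type*} [Field k] [Ring H] [HopfAlgebra k H] {K : Subalgebra k H}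

/-- The convolution product `x ↦ S(x₁) p(x₂ h)` of the antipode with `x ↦ p(x h)`, as a linear
function of `h`. -/
def twist (p : H →ₗ[k] H) : H →ₗ[k] H →ₗ[k] H where
  toFun h := (toConv (antipode k) * toConv (p ∘ₗ LinearMap.mulRight k h)).ofConv
  map_add' h h' := by
    ext x
    simp [(ℛ k x).convMul_apply, mul_add, Finset.sum_add_distrib]
  map_smul' a h := by
    ext x
    simp [(ℛ k x).convMul_apply, Finset.smul_sum]

lemma twist_apply (p : H →ₗ[k] H) (h x : H) {ι : Type*} (r : Repr k x ι) :
    twist p h x = ∑ i ∈ r.index, antipode k (r.left i) * p (r.right i * h) :=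
  r.convMul_apply _ _

/-- `twist` intertwines left multiplication on `h` with the diagonal action on linear maps. -/
lemma sum_mul_twist (p : H →ₗ[k] H) (h x a : H) {ι : Type*} (r : Repr k a ι) :
    ∑ i ∈ r.index, r.left i * twist p h (x * r.right i) = twist p (a * h) x := by
  let s := ℛ k x
  -- `F(w) = S(x₁) p(x₂ w h)`
  let F : H →ₗ[k] H := ∑ j ∈ s.index, LinearMap.mulLeft k (antipode k (s.left j)) ∘ₗ p ∘ₗ
    LinearMap.mulRight k h ∘ₗ LinearMap.mulLeft k (s.right j)
  -- as functions of `w`, `twist p h (x w) = S(w₁) F(w₂)`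
  have hF : toConv (twist p h ∘ₗ LinearMap.mulLeft k x) = toConv (antipode k) * toConv F := by
    ext w
    have hxw : comul (R := k) (x * w) = _ := Bialgebra.comul_mul x w
    rw [← s.eq, ← (ℛ k w).eq, Finset.sum_mul_sum] at hxw
    rw [(ℛ k w).convMul_apply]
    simp [twist, hxw, F, Finset.mul_sum, antipode_mul_antidistrib, mul_assoc]
    exact Finset.sum_comm
  have key : toConv LinearMap.id * toConv (twist p h ∘ₗ LinearMap.mulLeft k x) = toConv F := by
    rw [hF, ← mul_assoc, LinearMap.id_mul_antipode, one_mul]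
  have := congr($key a)
  rw [r.convMul_apply] at this
  refine this.trans ?_
  rw [twist_apply p _ x s]
  simp [F, mul_assoc]

/-- Linear maps on `H ⊗ H` that agree on `K ⊗ K` agree on `Δ(K)`. -/
lemma IsHopfSubalgebra.comul_congr (hK : IsHopfSubalgebra K) {x : H} (hx : x ∈ K) {M : Type*}
    [AddCommGroup M] [Module k M] {f g : H ⊗[k] H →ₗ[k] M}
    (hfg : ∀ a ∈ K, ∀ b ∈ K, f (a ⊗ₜ b) = g (a ⊗ₜ b)) : f (comul x) = g (comul x) := by
  obtain ⟨r, hl, hr⟩ := hK.exists_repr hx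
  rw [← r.eq, map_sum, map_sum]
  exact Finset.sum_congr rfl fun i _ => hfg _ (hl i) _ (hr i)

lemma IsHopfSubalgebra.twist_mem (hK : IsHopfSubalgebra K) {p : H →ₗ[k] H} (hp : ∀ y, p y ∈ K)
    (h : H) {x : H} (hx : x ∈ K) : twist p h x ∈ K := by
  obtain ⟨r, hl, hr⟩ := hK.exists_repr hx
  rw [twist_apply p h x r]
  exact sum_mem fun i _ => mul_mem (hK.antipode_mem _ (hl i)) (hp _)

/-- The linear map `a ⊗ b ↦ (z ↦ c(S(b) z) a)`. -/
def contract (c : H →ₗ[k] k) : H ⊗[k] H →ₗ[k] H →ₗ[k] H :=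
  TensorProduct.lift <| LinearMap.mk₂ k
    (fun a b => (c ∘ₗ LinearMap.mulLeft k (antipode k b)).smulRight a)
    (fun _ _ _ => by ext; simp) (fun _ _ _ => by ext; simp [smul_smul, mul_comm])
    (fun _ _ _ => by ext; simp [add_mul, add_smul])
    (fun _ _ _ => by ext; simp [mul_smul])

@[simp] lemma contract_tmul (c : H →ₗ[k] k) (a b z : H) :
    contract c (a ⊗ₜ b) z = c (antipode k b * z) • a := rfl

lemma contract_tmul_mul (c : H →ₗ[k] k) (u v z : H) (t : H ⊗[k] H) :
    contract c ((u ⊗ₜ v) * t) z = u * contract c t (antipode k v * z) := by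
  induction t with
  | zero => simp
  | add y z hy hz => rw [mul_add, map_add, map_add, LinearMap.add_apply, LinearMap.add_apply, hy,
      hz, mul_add]
  | tmul x y => simp [antipode_mul_antidistrib, mul_assoc]

lemma IsHopfSubalgebra.contract_comul_mem (hK : IsHopfSubalgebra K) (c : H →ₗ[k] k) (z : H)
    {x : H} (hx : x ∈ K) : contract c (comul x) z ∈ K := by
  obtain ⟨r, hl, -⟩ := hK.exists_repr hx
  rw [← r.eq, map_sum, LinearMap.sum_apply]
  exact sum_mem fun i _ => K.smul_mem (hl i) _

/-- The partial trace `z ↦ ∑ᵢ cᵢ(S(F(eᵢ)₂) z) F(eᵢ)₁` of a linear map `F`, where `(e, c)` is to be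
a dual basis of `K`. -/
def partialTrace {ι : Type*} [Fintype ι] (e : ι → H) (c : ι → H →ₗ[k] k) (F : H →ₗ[k] H) :
    H →ₗ[k] H :=
  ∑ i, contract (c i) (comul (F (e i)))

variable {ι : Type*} [Fintype ι] {e : ι → H} {c : ι → H →ₗ[k] k}

/-- Expanding `eᵢ w` in the basis `e` moves `w` from the argument of `F` to that of the dual
basis. -/
lemma IsHopfSubalgebra.partialTrace_comp_mulRight (hK : IsHopfSubalgebra K) (he : ∀ i, e i ∈ K)
    (hec : ∀ x ∈ K, ∑ i, c i x • e i = x) {F : H →ₗ[k] H} (hF : ∀ x ∈ K, F x ∈ K)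
    {y w : H} (hy : y ∈ K) (hw : w ∈ K) :
    partialTrace e c (F ∘ₗ LinearMap.mulRight k w) y = partialTrace e c F (y * w) := by
  have key : ∀ j, ∑ i, c j (e i * w) • contract (c i) (comul (F (e j))) y =
      contract (c j) (comul (F (e j))) (y * w) := fun j => by
    have := hK.comul_congr (hF _ (he j))
      (f := ∑ i, c j (e i * w) • LinearMap.applyₗ y ∘ₗ contract (c i))
      (g := LinearMap.applyₗ (y * w) ∘ₗ contract (c j)) fun a _ b hb => by
        have h := congr(c j ($(hec _ (mul_mem (hK.antipode_mem _ hb) hy)) * w))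
        rw [Finset.sum_mul, map_sum] at h
        simp only [smul_mul_assoc, map_smul, smul_eq_mul] at h
        simp [smul_smul, ← Finset.sum_smul, mul_comm (c j _), h, mul_assoc]
    simpa using this
  simp only [partialTrace, LinearMap.sum_apply, ← key]
  rw [Finset.sum_comm]
  refine Finset.sum_congr rfl fun i _ => ?_
  have h := hec _ (mul_mem (he i) hw)
  have h' := congr(contract (c i) (comul (F $h)) y)
  simp only [map_sum, map_smul, LinearMap.sum_apply, LinearMap.smul_apply] at h'
  exact h'.symm

/-- The map `h ↦ partialTrace e c (twist p h) 1`, which is the retraction onto `K`, is left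
`K`-linear. -/
lemma IsHopfSubalgebra.partialTrace_twist_mul (hK : IsHopfSubalgebra K) (he : ∀ i, e i ∈ K)
    (hec : ∀ x ∈ K, ∑ i, c i x • e i = x) {p : H →ₗ[k] H} (hp : ∀ x, p x ∈ K) (h : H)
    {a : H} (ha : a ∈ K) :
    partialTrace e c (twist p (a * h)) 1 = a * partialTrace e c (twist p h) 1 := by
  obtain ⟨r, hl, hr⟩ := hK.exists_repr ha
  choose s hsl hsr using fun i => hK.exists_repr (hl i)
  set τ := partialTrace e c (twist p h) with hτ
  have h₁ : partialTrace e c (twist p (a * h)) 1 = ∑ i ∈ r.index, ∑ j ∈ (s i).index,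
      (s i).left j * τ (antipode k ((s i).right j) * r.right i) := by
    have : ∀ i j, τ (antipode k ((s i).right j) * r.right i) = _ := fun i j =>
      (hK.partialTrace_comp_mulRight he hec (fun x hx => hK.twist_mem hp h hx)
        (hK.antipode_mem _ (hsr i j)) (hr i)).symm
    simp only [this, partialTrace, LinearMap.sum_apply, Finset.mul_sum, LinearMap.comp_apply,
      LinearMap.mulRight_apply, ← sum_mul_twist p h _ a r, map_sum, Bialgebra.comul_mul,
      ← (s _).eq, Finset.sum_mul, contract_tmul_mul, mul_one]
    rw [Finset.sum_comm]
    refine Finset.sum_congr rfl fun i _ => ?_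
    rw [Finset.sum_comm]
  -- `a₁ τ(S(a₂) a₃) = a τ(1)`
  have h₂ := congr((LinearMap.mul' k H ∘ₗ TensorProduct.map LinearMap.id (τ ∘ₗ LinearMap.mul' k H
    ∘ₗ TensorProduct.map (antipode k) LinearMap.id))
    $(sum_tmul_tmul_eq r s fun i => ℛ k (r.right i)))
  simp only [map_sum, LinearMap.comp_apply, TensorProduct.map_tmul, LinearMap.mul'_apply,
    LinearMap.id_apply] at h₂
  rw [h₁, h₂]
  simp only [← Finset.mul_sum, ← map_sum, sum_antipode_mul_eq_smul]
  simp only [map_smul, mul_smul_comm, ← smul_mul_assoc, ← Finset.sum_mul]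
  congr 1
  have h₃ := congr(TensorProduct.rid k H $(sum_tmul_counit_eq r))
  rwa [map_sum, TensorProduct.rid_tmul, one_smul] at h₃

lemma IsHopfSubalgebra.partialTrace_twist_one (hK : IsHopfSubalgebra K) (he : ∀ i, e i ∈ K)
    (hec : ∀ x ∈ K, ∑ i, c i x • e i = x) {p : H →ₗ[k] H} (hp : ∀ x ∈ K, p x = x) :
    partialTrace e c (twist p 1) 1 = 1 := by
  have h : ∀ x ∈ K, twist p 1 x = counit (R := k) x • 1 := fun x hx => by
    obtain ⟨r, -, hr⟩ := hK.exists_repr hx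
    rw [twist_apply p 1 x r, ← sum_antipode_mul_eq_smul r]
    exact Finset.sum_congr rfl fun i _ => by rw [mul_one, hp _ (hr i)]
  have h₁ := congr(counit (R := k) $(hec 1 K.one_mem))
  simp only [map_sum, map_smul, smul_eq_mul, Bialgebra.counit_one] at h₁
  simp [partialTrace, h _ (he _), Algebra.TensorProduct.one_def, smul_smul, ← Finset.sum_smul,
    mul_comm, h₁]

/-- A linear projection of `H` onto `K` together with a dual basis of `K` whose coordinate
functions are extended to `H`. -/
lemma exists_projection_dualBasis (K : Subalgebra k H) [Module.Finite k K] :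
    ∃ (p : H →ₗ[k] H) (e : Fin (Module.finrank k K) → H)
      (c : Fin (Module.finrank k K) → H →ₗ[k] k), (∀ x, p x ∈ K) ∧ (∀ x ∈ K, p x = x) ∧
      (∀ i, e i ∈ K) ∧ ∀ x ∈ K, ∑ i, c i x • e i = x := by
  obtain ⟨p, hp⟩ := K.val.toLinearMap.exists_leftInverse_of_injective
    (LinearMap.ker_eq_bot.mpr Subtype.val_injective)
  have hp' : ∀ x (hx : x ∈ K), p x = ⟨x, hx⟩ := fun x hx => LinearMap.congr_fun hp ⟨x, hx⟩
  let b := Module.finBasis k K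
  refine ⟨K.val.toLinearMap ∘ₗ p, fun i => b i, fun i => b.coord i ∘ₗ p, fun x => (p x).2,
    fun x hx => congr(($(hp' x hx) : H)), fun i => (b i).2, fun x hx => ?_⟩
  have h := congr(K.val $(b.sum_repr ⟨x, hx⟩))
  rw [map_sum] at h
  simpa only [LinearMap.comp_apply, hp' x hx] using! h

/-- A finite-dimensional Hopf subalgebra `K ⊆ H` is a direct summand of `H` as a left
`K`-module. -/
theorem IsHopfSubalgebra.exists_retraction (hK : IsHopfSubalgebra K) [Module.Finite k K] :
    ∃ r : H →ₗ[k] H, (∀ h, r h ∈ K) ∧ (∀ a ∈ K, ∀ h, r (a * h) = a * r h) ∧ r 1 = 1 := by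
  obtain ⟨p, e, c, hpK, hp, he, hec⟩ := exists_projection_dualBasis K
  let r : H →ₗ[k] H := (∑ i, LinearMap.applyₗ 1 ∘ₗ contract (c i) ∘ₗ comul ∘ₗ
    LinearMap.applyₗ (e i)) ∘ₗ twist p
  have hr : ∀ h, r h = partialTrace e c (twist p h) 1 := fun h => by simp [r, partialTrace]
  refine ⟨r, fun h => ?_, fun a ha h => ?_, ?_⟩
  · rw [hr, partialTrace, LinearMap.sum_apply]
    exact sum_mem fun i _ => hK.contract_comul_mem _ _ (hK.twist_mem hpK h (he i))
  · rw [hr, hr, hK.partialTrace_twist_mul he hec hpK h ha]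
  · rw [hr, hK.partialTrace_twist_one he hec hp]

end Retraction

/-! ### Coinvariants -/

section Coinvariants

variable {k H : Type*} [Field k] [Ring H] [HopfAlgebra k H] {K : Subalgebra k H}

/-- If `1 ⊗_K a = a ⊗_K 1` then `a ∈ K`, because `K` is a direct summand of `H`. -/
lemma IsHopfSubalgebra.mem_of_tmul_eq (hK : IsHopfSubalgebra K) [Module.Finite k K] {a : H}
    (ha : TensorSquare.tmul K 1 a = TensorSquare.tmul K a 1) : a ∈ K := by
  obtain ⟨r, hrK, hr, hr₁⟩ := hK.exists_retraction
  have := congr(TensorSquare.lift ((LinearMap.mul k H).compl₂ r)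
    (fun x y b hb => by simp [hr b hb, mul_assoc]) $ha)
  have h : r a = a := by simpa [hr₁] using this
  exact h ▸ hrK a

variable [(augmentationIdeal K).IsTwoSided] [(augmentationIdeal K).IsHopfIdeal k]

lemma IsNormalHopfSubalgebra.coinvariants_eq (hK : IsNormalHopfSubalgebra K) [Module.Finite k K] :
    coinvariants (C := H ⧸ augmentationIdeal K) (naturalCoaction K) = K := by
  refine le_antisymm (fun a ha => hK.mem_of_tmul_eq ?_) hK.le_coinvariants
  have ha : naturalCoaction K a = a ⊗ₜ 1 := ha
  apply (hK.galoisEquiv hK.le_coinvariants).injective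
  change galoisMap (C := H ⧸ augmentationIdeal K) _ _ hK.le_coinvariants _ =
    galoisMap (C := H ⧸ augmentationIdeal K) _ _ hK.le_coinvariants _
  rw [galoisMap_tmul, galoisMap_tmul, map_one, ha]
  simp

end Coinvariants

/-! ### Depth two -/

section DepthTwo

variable {k A : Type*} [Field k] [Ring A] [Algebra k A]

lemma isBimoduleSummand_of_equiv {M N : Type*} [AddCommGroup M] [Module k M] [Module A M]
    [Module Aᵐᵒᵖ M] [AddCommGroup N] [Module k N] [Module A N] [Module Aᵐᵒᵖ N]
    {L R : Subalgebra k A} (f : M ≃ₗ[k] N) (hL : ∀ a ∈ L, ∀ x, f (a • x) = a • f x)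
    (hR : ∀ a ∈ R, ∀ x, f (MulOpposite.op a • x) = MulOpposite.op a • f x) :
    IsBimoduleSummand M N L R :=
  ⟨⊤, ⊥, ⟨fun _ _ _ _ => trivial, fun _ _ _ _ => trivial⟩,
    ⟨fun _ _ x hx => by rw [(Submodule.mem_bot k).mp hx, smul_zero]; exact zero_mem _,
      fun _ _ x hx => by rw [(Submodule.mem_bot k).mp hx, smul_zero]; exact zero_mem _⟩,
    isCompl_top_bot, f.trans (LinearEquiv.ofTop ⊤ rfl).symm, hL, hR⟩

variable {C : Type*} [Ring C] [Algebra k C] [Module.Finite k C]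

/-- If `A ⊗_B A ≅ A ⊗ C` compatibly with the actions on the factor `A`, a basis of `C` identifies
it with `Aⁿ`. -/
lemma isRightDepthTwo_of_equiv {B : Subalgebra k A} (f : TensorSquare B ≃ₗ[k] A ⊗[k] C)
    (hL : ∀ a x, f (a • x) = (a ⊗ₜ 1) * f x)
    (hR : ∀ a ∈ B, ∀ x, f (MulOpposite.op a • x) = f x * (a ⊗ₜ 1)) : IsRightDepthTwo B := by
  let g : A ⊗[k] C ≃ₗ[k] (Fin (Module.finrank k C) → A) :=
    (TensorProduct.equivFinsuppOfBasisRight (Module.finBasis k C)).trans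
      (Finsupp.linearEquivFunOnFinite k A _)
  have hgL : ∀ a z, g ((a ⊗ₜ 1) * z) = a • g z := fun a z => by
    induction z with
    | zero => simp
    | add y z hy hz => rw [mul_add, map_add, hy, hz, map_add, smul_add]
    | tmul x y => ext i; simp [g]
  have hgR : ∀ a z, g (z * (a ⊗ₜ 1)) = MulOpposite.op a • g z := fun a z => by
    induction z with
    | zero => simp
    | add y z hy hz => rw [add_mul, map_add, hy, hz, map_add, smul_add]
    | tmul x y => ext i; simp [g]
  exact ⟨_, isBimoduleSummand_of_equiv (f.trans g)
    (fun a _ x => by simp [hL, hgL]) (fun a ha x => by simp [hR a ha, hgR])⟩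

lemma isLeftDepthTwo_of_equiv {B : Subalgebra k A} (f : TensorSquare B ≃ₗ[k] C ⊗[k] A)
    (hL : ∀ a ∈ B, ∀ x, f (a • x) = (1 ⊗ₜ a) * f x)
    (hR : ∀ a x, f (MulOpposite.op a • x) = f x * (1 ⊗ₜ a)) : IsLeftDepthTwo B := by
  let g : C ⊗[k] A ≃ₗ[k] (Fin (Module.finrank k C) → A) :=
    (TensorProduct.equivFinsuppOfBasisLeft (Module.finBasis k C)).trans
      (Finsupp.linearEquivFunOnFinite k A _)
  have hgL : ∀ a z, g ((1 ⊗ₜ a) * z) = a • g z := fun a z => by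
    induction z with
    | zero => simp
    | add y z hy hz => rw [mul_add, map_add, hy, hz, map_add, smul_add]
    | tmul x y => ext i; simp [g]
  have hgR : ∀ a z, g (z * (1 ⊗ₜ a)) = MulOpposite.op a • g z := fun a z => by
    induction z with
    | zero => simp
    | add y z hy hz => rw [add_mul, map_add, hy, hz, map_add, smul_add]
    | tmul x y => ext i; simp [g]
  exact ⟨_, isBimoduleSummand_of_equiv (f.trans g)
    (fun a ha x => by simp [hL a ha, hgL]) (fun a _ x => by simp [hR, hgR])⟩

end DepthTwo

end HopfDepthTwo

end

theorem mainTheorem8 {k H : Type*} [Field k] [Ring H] [HopfAlgebra k H] [Module.Finite k H]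
    (K : Subalgebra k H) (hK : HopfDepthTwo.IsNormalHopfSubalgebra K) :
    ∃ (_ : (HopfDepthTwo.augmentationIdeal K).IsTwoSided)
      (_ : (HopfDepthTwo.augmentationIdeal K).IsHopfIdeal k),
      HopfDepthTwo.IsGaloisExtension (C := H ⧸ HopfDepthTwo.augmentationIdeal K)
        (HopfDepthTwo.naturalCoaction K) K ∧
      HopfDepthTwo.IsDepthTwo K := by
  have h₁ := hK.isTwoSided
  have h₂ := hK.isHopfIdeal
  have hH : Module.Finite k (H ⧸ HopfDepthTwo.augmentationIdeal K) :=
    Module.Finite.of_surjective (Ideal.Quotient.mkₐ k _).toLinearMap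
      (Ideal.Quotient.mkₐ_surjective k _)
  have hβ := hK.le_coinvariants
  refine ⟨h₁, h₂, ⟨HopfDepthTwo.isComoduleAlgebra_naturalCoaction, hK.coinvariants_eq,
    (hK.galoisEquiv hβ).bijective⟩, ?_, ?_⟩
  · refine HopfDepthTwo.isLeftDepthTwo_of_equiv hK.leftGaloisEquiv (fun a ha x => ?_)
      hK.leftGaloisMap_op_smul
    rw [← hK.leftCoaction_of_mem ha]
    exact hK.leftGaloisMap_smul a x
  · refine HopfDepthTwo.isRightDepthTwo_of_equiv (hK.galoisEquiv hβ)
      (HopfDepthTwo.galoisMap_smul hβ) (fun a ha x => ?_)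
    rw [← hK.naturalCoaction_of_mem ha]
    exact HopfDepthTwo.galoisMap_op_smul hβ a x
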